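/- Let $\mathcal{A}=(A,E)$ be a computable equivalence structure: $A\subseteq\omega$ is a computable set and $E$ is an equivalence relation on $A$ that is computable (as a set of pairs). Let $C\subseteq\omega$ be a cohesive set, that is, $C$ is infinite and for every c.e. set $W$ either $W\cap C$ or $\overline{W}\cap C$ is finite. Write $X\subseteq^{*}Y$ if $X\setminus Y$ is finite. The cohesive power $\Pi_C\mathcal{A}$ is the structure whose elements are the classes $[\psi]$ of partial computable functions $\psi:\omega\to A$ with $C\subseteq^{*}\mathrm{dom}(\psi)$, where $[\psi_1]=[\psi_2]$ iff $C\subseteq^{*}\{i:\psi_1(i)\downarrow=\psi_2(i)\downarrow\}$, and whose relation holds of $[\psi_1],[\psi_2]$ iff $C\subseteq^{*}\{i:\psi_1(i)\downarrow,\ \psi_2(i)\downarrow\text{ and }\psi_1(i)\,E\,\psi_2(i)\}$. Say that $\mathcal{A}$ has bounded character if there is a finite $k$ such that all finite equivalence classes of $\mathcal{A}$ have size at most $k$. Then $\Pi_C\mathcal{A}\cong\mathcal{A}$ if and only if $\mathcal{A}$ has bounded character or $\mathcal{A}$ has infinitely many infinite equivalence classes. -/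

import Mathlib

/-! Cohesive powers of computable equivalence structures. -/

namespace CohesivePower

/-- Inclusion up to finitely many elements, `X ⊆* Y`. -/
def AlmostSubset (X Y : Set ℕ) : Prop := (X \ Y).Finite

/-- A cohesive set: an infinite set of natural numbers that no c.e. set splits into two
infinite parts. -/
def IsCohesive (C : Set ℕ) : Prop :=
  C.Infinite ∧
    ∀ W : Set ℕ, REPred (fun n => n ∈ W) → (W ∩ C).Finite ∨ (Wᶜ ∩ C).Finite

/-- The structure `(A, E)`, whose domain is a set `A` of natural numbers and which has one binary
relation `E`, is computable: `A` is a computable set, and `E`, as a set of pairs of natural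
numbers, is computable. -/
def IsComputableStructure (A : Set ℕ) (E : A → A → Prop) : Prop :=
  ComputablePred (fun n : ℕ => n ∈ A) ∧
    ComputablePred (fun p : ℕ × ℕ => ∃ a b : A, (a : ℕ) = p.1 ∧ (b : ℕ) = p.2 ∧ E a b)

/-- The partial computable functions from `ℕ` to `A` whose domain contains almost all of `C`. -/
def PreDomain (A C : Set ℕ) : Type :=
  {ψ : ℕ →. ℕ // Nat.Partrec ψ ∧ (∀ i, ∀ a ∈ ψ i, a ∈ A) ∧ AlmostSubset C ψ.Dom}

/-- `ψ₁ =_C ψ₂`: for almost all `i ∈ C` the values of `ψ₁` and `ψ₂` at `i` are defined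
and equal. -/
def EqOn {A C : Set ℕ} (ψ₁ ψ₂ : PreDomain A C) : Prop :=
  AlmostSubset C {i | ∃ a, a ∈ ψ₁.1 i ∧ a ∈ ψ₂.1 i}

theorem eqOn_equivalence (A C : Set ℕ) : Equivalence (EqOn (A := A) (C := C)) where
  refl ψ := by
    refine ψ.2.2.2.subset (Set.sdiff_subset_sdiff_right ?_)
    intro i hi
    obtain ⟨a, ha⟩ := (PFun.mem_dom _ _).1 hi
    exact ⟨a, ha, ha⟩
  symm {ψ φ} h := by
    refine Set.Finite.subset h (Set.sdiff_subset_sdiff_right ?_)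
    rintro i ⟨a, h1, h2⟩
    exact ⟨a, h2, h1⟩
  trans {ψ φ χ} h h' := by
    refine (Set.Finite.union h h').subset ?_
    rintro i ⟨hC, hi⟩
    by_contra hn
    simp only [Set.mem_union, Set.mem_sdiff, not_or, not_and, not_not] at hn
    obtain ⟨a, h1, h2⟩ := hn.1 hC
    obtain ⟨b, h3, h4⟩ := hn.2 hC
    obtain rfl := Part.mem_unique h2 h3
    exact hi ⟨a, h1, h4⟩

/-- The equivalence relation `=_C`. -/
def eqSetoid (A C : Set ℕ) : Setoid (PreDomain A C) := ⟨EqOn, eqOn_equivalence A C⟩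

/-- The domain of the cohesive power over `C` of a structure with domain `A`. -/
def Domain (A C : Set ℕ) : Type := Quotient (eqSetoid A C)

/-- `E(ψ₁(i), ψ₂(i))` holds for almost all `i ∈ C`. -/
def PreRel {A : Set ℕ} (E : A → A → Prop) {C : Set ℕ} (ψ₁ ψ₂ : PreDomain A C) : Prop :=
  AlmostSubset C {i | ∃ a b : A, (a : ℕ) ∈ ψ₁.1 i ∧ (b : ℕ) ∈ ψ₂.1 i ∧ E a b}

theorem PreRel.congr {A : Set ℕ} {E : A → A → Prop} {C : Set ℕ} {ψ₁ ψ₂ φ₁ φ₂ : PreDomain A C}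
    (h₁ : EqOn ψ₁ φ₁) (h₂ : EqOn ψ₂ φ₂) (h : PreRel E ψ₁ ψ₂) : PreRel E φ₁ φ₂ := by
  refine ((Set.Finite.union h₁ h₂).union h).subset ?_
  rintro i ⟨hC, hi⟩
  by_contra hn
  simp only [Set.mem_union, Set.mem_sdiff, not_or, not_and, not_not] at hn
  obtain ⟨⟨hn1, hn2⟩, hn3⟩ := hn
  obtain ⟨c, h1, h2⟩ := hn1 hC
  obtain ⟨d, h3, h4⟩ := hn2 hC
  obtain ⟨a, b, h5, h6, hab⟩ := hn3 hC
  obtain rfl := Part.mem_unique h1 h5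
  obtain rfl := Part.mem_unique h3 h6
  exact hi ⟨a, b, h2, h4, hab⟩

/-- The relation of the cohesive power of `(A, E)` over `C`. -/
def Rel {A : Set ℕ} (E : A → A → Prop) (C : Set ℕ) : Domain A C → Domain A C → Prop :=
  Quotient.lift₂ (s₁ := eqSetoid A C) (s₂ := eqSetoid A C) (PreRel E)
    (fun _ _ _ _ h₁ h₂ => propext
      ⟨PreRel.congr h₁ h₂,
        PreRel.congr ((eqOn_equivalence A C).symm h₁) ((eqOn_equivalence A C).symm h₂)⟩)

/-- The equivalence class of `a` in the equivalence structure `(α, E)`. -/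
def eqv {α : Type*} (E : α → α → Prop) (a : α) : Set α := {x | E x a}

/-- Bounded character: some finite `k` bounds the sizes of all finite equivalence classes. -/
def HasBoundedCharacter {α : Type*} (E : α → α → Prop) : Prop :=
  ∃ k : ℕ, ∀ a : α, (eqv E a).Finite → (eqv E a).ncard ≤ k

/-- There are infinitely many infinite equivalence classes. -/
def HasInfinitelyManyInfiniteClasses {α : Type*} (E : α → α → Prop) : Prop :=
  {S : Set α | (∃ a : α, S = eqv E a) ∧ S.Infinite}.Infinite

end CohesivePower

/-!
A countable equivalence structure is determined up to isomorphism by the number, at most `ℵ₀`, of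
its classes of each size (`nonempty_relIso_of_classes`), and both `(A, E)` and its cohesive power
are countable. They are compared along the embedding `a ↦ [constant a]`.

The c.e. sets are decided by the cohesive set `C`: each contains almost all of `C` or is almost
disjoint from it. As `E` is computable, "the class of `ψ i` has at least `n` elements" is a c.e.
condition on `i`, and the elements of a class can be listed computably. It follows that the class
of `[ψ]` has at least `n` elements iff the class of `ψ i` does for almost all `i ∈ C`
(`le_encard_eqv_mk_iff`). In particular constants preserve the sizes of classes, and if the class
of `[ψ]` has finite size `n`, then so do almost all classes of the `ψ i`; under bounded character
the same holds for infinite size (`eventually_encard_eq`). When `(A, E)` has only finitely many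
classes of that size, cohesiveness picks one of them, so that `[ψ]` is equivalent to a constant
(`exists_rel_constFun`). When it has infinitely many, both structures have `ℵ₀` of them. So
bounded character, or infinitely many infinite classes, gives an isomorphism.

Conversely, suppose that the finite classes are unbounded and there are only finitely many infinite
classes. Searching outside the infinite classes for an element `ψ i` with more than `i`
equivalents gives an infinite class `[ψ]` of the power that contains no constant
(`exists_infinite_class`). The power therefore has more infinite classes than `(A, E)`, which is
impossible for isomorphic structures when the latter number is finite
(`exists_rel_constFun_of_relIso`).
-/

namespace CohesivePower

open Filter

/-! ### Countable equivalence structures -/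

theorem nonempty_equiv_of_enatCard_eq {α β : Type} [Countable α] [Countable β]
    (h : ENat.card α = ENat.card β) : Nonempty (α ≃ β) :=
  Cardinal.eq.1 (Cardinal.toENat_injOn (Cardinal.mk_le_aleph0 (α := α))
    (Cardinal.mk_le_aleph0 (α := β)) h)

/-- The equivalence classes of a given size. -/
def classesOfSize {α : Type*} (E : α → α → Prop) (κ : ℕ∞) : Set (Set α) :=
  {S | (∃ a : α, S = eqv E a) ∧ S.encard = κ}

theorem eqv_eq_iff {α : Type*} {r : α → α → Prop} (hr : Equivalence r) {a b : α} :
    eqv r a = eqv r b ↔ r a b := by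
  refine ⟨fun h => ?_, fun h => Set.ext fun x => ⟨fun hx => hr.trans hx h,
    fun hx => hr.trans hx (hr.symm h)⟩⟩
  have : a ∈ eqv r a := hr.refl a
  rwa [h] at this

/-- A countable equivalence structure is determined by the number of its classes of each size.
Here the two numbers are compared along a size preserving embedding `D`: for each size, either
there are infinitely many classes (hence `ℵ₀` in both structures) or `D` meets every class of
that size. -/
theorem nonempty_relIso_of_classes {α β : Type} [Countable α] [Countable β]
    {r : α → α → Prop} {s : β → β → Prop} (hr : Equivalence r) (hs : Equivalence s)
    (D : α → β) (hD : ∀ a b, s (D a) (D b) ↔ r a b)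
    (hcard : ∀ a, (eqv s (D a)).encard = (eqv r a).encard)
    (h : ∀ κ : ℕ∞, (classesOfSize r κ).Infinite ∨
      ∀ b, (eqv s b).encard = κ → ∃ a, s b (D a)) : Nonempty (s ≃r r) := by
  classical
  let R : Setoid α := ⟨r, hr⟩
  let S : Setoid β := ⟨s, hs⟩
  let cr : Quotient R → Set α := Quotient.lift (eqv r) fun a b hab => (eqv_eq_iff hr).2 hab
  let cs : Quotient S → Set β := Quotient.lift (eqv s) fun a b hab => (eqv_eq_iff hs).2 hab
  let kr : Quotient R → ℕ∞ := fun q => (cr q).encard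
  let ks : Quotient S → ℕ∞ := fun q => (cs q).encard
  let Dq : Quotient R → Quotient S := Quotient.map D fun a b hab => (hD a b).2 hab
  have hDq : Function.Injective Dq := by
    intro p q
    refine Quotient.inductionOn₂ p q fun a b hab => ?_
    exact Quotient.sound ((hD a b).1 (Quotient.exact hab))
  have hk : ∀ q, ks (Dq q) = kr q := fun q => Quotient.inductionOn q hcard
  have key : ∀ κ, Nonempty ({q // ks q = κ} ≃ {q // kr q = κ}) := by
    intro κ
    let f : {q // kr q = κ} → {q // ks q = κ} := fun q => ⟨Dq q.1, (hk q.1).trans q.2⟩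
    have hf : Function.Injective f := fun p q hpq => Subtype.ext (hDq (congrArg Subtype.val hpq))
    rcases h κ with h | h
    · have : Infinite {q // kr q = κ} := by
        refine Set.infinite_coe_iff.2 (Set.Infinite.of_image cr (h.mono ?_))
        rintro _ ⟨⟨a, rfl⟩, ha⟩
        exact ⟨Quotient.mk R a, ha, rfl⟩
      have := Infinite.of_injective f hf
      exact nonempty_equiv_of_countable
    · refine ⟨(Equiv.ofBijective f ⟨hf, ?_⟩).symm⟩
      rintro ⟨q, hq⟩
      induction q using Quotient.inductionOn with
      | h b =>
        obtain ⟨a, ha⟩ := h b hq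
        have hb : ks (Quotient.mk S b) = kr (Quotient.mk R a) := by
          rw [← hk]
          exact congrArg ks (Quotient.sound ha)
        exact ⟨⟨Quotient.mk R a, hb.symm.trans hq⟩, Subtype.ext (Quotient.sound (hs.symm ha))⟩
  let e : Quotient S ≃ Quotient R := (Equiv.sigmaFiberEquiv ks).symm.trans
    ((Equiv.sigmaCongrRight fun κ => (key κ).some).trans (Equiv.sigmaFiberEquiv kr))
  have he : ∀ q, kr (e q) = ks q := fun q => ((key (ks q)).some ⟨q, rfl⟩).2
  have fib : ∀ q, Nonempty ({b // Quotient.mk S b = q} ≃ {a // Quotient.mk R a = e q}) := by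
    intro q
    have h1 : {b | Quotient.mk S b = q} = cs q := by
      induction q using Quotient.inductionOn with
      | h b => exact Set.ext fun x => Quotient.eq
    have h2 : ∀ q', {a | Quotient.mk R a = q'} = cr q' := by
      intro q'
      induction q' using Quotient.inductionOn with
      | h b => exact Set.ext fun x => Quotient.eq
    apply nonempty_equiv_of_enatCard_eq
    change Set.encard {b | Quotient.mk S b = q} = Set.encard {a | Quotient.mk R a = e q}
    rw [h1, h2]
    exact (he q).symm
  let f : β ≃ α := (Equiv.sigmaFiberEquiv (Quotient.mk S)).symm.trans
    ((Equiv.sigmaCongr e fun q => (fib q).some).trans (Equiv.sigmaFiberEquiv (Quotient.mk R)))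
  have hf : ∀ b, Quotient.mk R (f b) = e (Quotient.mk S b) :=
    fun b => ((fib (Quotient.mk S b)).some ⟨b, rfl⟩).2
  refine ⟨⟨f, fun {b b'} => ?_⟩⟩
  change R (f b) (f b') ↔ S b b'
  rw [← Quotient.eq, hf, hf, e.injective.eq_iff, Quotient.eq]

/-! ### Computable enumeration of the classes -/

/-- The relation `E` as a set of pairs of natural numbers. -/
def natRel {A : Set ℕ} (E : A → A → Prop) (p : ℕ × ℕ) : Prop :=
  ∃ a b : A, (a : ℕ) = p.1 ∧ (b : ℕ) = p.2 ∧ E a b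

theorem natRel_coe {A : Set ℕ} {E : A → A → Prop} {a b : A} :
    natRel E (a, b) ↔ E a b := by
  constructor
  · rintro ⟨a', b', h1, h2, h⟩
    obtain rfl := Subtype.ext h1
    obtain rfl := Subtype.ext h2
    exact h
  · exact fun h => ⟨a, b, rfl, rfl, h⟩

theorem encard_natRel {A : Set ℕ} (E : A → A → Prop) (a : A) :
    {y | natRel E (y, a)}.encard = (eqv E a).encard := by
  rw [← Subtype.val_injective.encard_image (eqv E a)]
  congr 1
  ext y
  constructor
  · rintro ⟨b, a', rfl, h2, h⟩
    obtain rfl := Subtype.ext h2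
    exact ⟨b, h, rfl⟩
  · rintro ⟨b, h, rfl⟩
    exact natRel_coe.2 h

theorem succ_le_encard_iff {p : ℕ → Prop} [DecidablePred p] {j : ℕ} :
    ((j + 1 : ℕ) : ℕ∞) ≤ {y | p y}.encard ↔ ∃ y, p y ∧ Nat.count p y = j := by
  constructor
  · intro h
    have hj : ∀ hf : (Set.ofPred p).Finite, j < hf.toFinset.card := by
      intro hf
      change _ ≤ (Set.ofPred p).encard at h
      rw [hf.encard_eq_coe_toFinset_card] at h
      exact Nat.cast_le.1 h
    exact ⟨Nat.nth p j, Nat.nth_mem j hj, Nat.count_nth hj⟩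
  · rintro ⟨y, hy, rfl⟩
    rw [← Nat.count_succ_eq_succ_count_iff.2 hy, Nat.count_eq_card_filter_range,
      ← Set.encard_coe_eq_coe_finsetCard]
    exact Set.encard_le_encard fun x hx => (Finset.mem_filter.1 hx).2

theorem computable_count {p : ℕ × ℕ → Prop} [DecidablePred p] (hp : ComputablePred p) :
    Computable fun q : ℕ × ℕ => Nat.count (fun y => p (y, q.1)) q.2 := by
  have hs : Computable₂ fun (q : ℕ × ℕ) (c : ℕ × ℕ) =>
      cond (decide (p (c.1, q.1))) (c.2 + 1) c.2 := by
    refine Computable.cond ?_ ?_ ?_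
    · exact hp.decide.comp ((Computable.fst.comp .snd).pair (Computable.fst.comp .fst))
    · exact Computable.succ.comp (Computable.snd.comp .snd)
    · exact Computable.snd.comp .snd
  refine (Computable.nat_rec Computable.snd (Computable.const 0) hs).of_eq ?_
  rintro ⟨x, t⟩
  induction t with
  | zero => simp
  | succ t ih =>
    rw [Nat.count_succ]
    simp only at ih ⊢
    rw [ih]
    by_cases h : p (t, x) <;> simp [h]

theorem computablePred_count {p : ℕ × ℕ → Prop} [DecidablePred p] (hp : ComputablePred p) :
    ComputablePred fun q : (ℕ × ℕ) × ℕ =>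
      p (q.1.2, q.1.1) ∧ Nat.count (fun y => p (y, q.1.1)) q.1.2 = q.2 := by
  refine Computable.computablePred ((Primrec.and.to_comp.comp
    (hp.decide.comp ((Computable.snd.comp .fst).pair (Computable.fst.comp .fst)))
    ((Primrec.eq (α := ℕ)).decide.to_comp.comp
      ((computable_count hp).comp .fst) .snd)).of_eq ?_)
  intro q
  simp

/-- The `j`-th element, in increasing order and counting from `0`, of the class `{y | p (y, x)}`
of `x`; undefined if that class has at most `j` elements. -/
def nthInClass (p : ℕ × ℕ → Prop) [DecidablePred p] (j x : ℕ) : Part ℕ :=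
  Nat.rfind fun y => Part.some (decide (p (y, x) ∧ Nat.count (fun y => p (y, x)) y = j))

theorem mem_nthInClass {p : ℕ × ℕ → Prop} [DecidablePred p] {j x y : ℕ}
    (h : y ∈ nthInClass p j x) : p (y, x) ∧ Nat.count (fun y => p (y, x)) y = j := by
  simpa using Nat.rfind_spec h

theorem nthInClass_dom {p : ℕ × ℕ → Prop} [DecidablePred p] {j x : ℕ} :
    (nthInClass p j x).Dom ↔ ((j + 1 : ℕ) : ℕ∞) ≤ {y | p (y, x)}.encard := by
  rw [succ_le_encard_iff]
  refine Nat.rfind_dom.trans ?_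
  simp

theorem partrec_nthInClass {p : ℕ × ℕ → Prop} [DecidablePred p] (hp : ComputablePred p) (j : ℕ) :
    Partrec (nthInClass p j) := by
  refine Partrec.rfind (p := fun x y =>
    Part.some (decide (p (y, x) ∧ Nat.count (fun y => p (y, x)) y = j))) ?_
  exact (((computablePred_count hp).decide.comp (Computable.id.pair (Computable.const j)) :
    Computable fun q : ℕ × ℕ => _).partrec)

theorem rePred_le_encard {p : ℕ × ℕ → Prop} (hp : ComputablePred p) (n : ℕ) :
    REPred fun x => (n : ℕ∞) ≤ {y | p (y, x)}.encard := by
  classical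
  cases n with
  | zero => exact (ComputablePred.to_re
      ((Computable.const true).computablePred (p := fun _ : ℕ => True))).of_eq (by simp)
  | succ j => exact (partrec_nthInClass hp j).dom_re.of_eq fun x => nthInClass_dom

theorem REPred.exists_mem {p : ℕ × ℕ → Prop} (hp : REPred p) {f g : ℕ →. ℕ} (hf : Partrec f)
    (hg : Partrec g) : REPred fun i => ∃ x ∈ f i, ∃ y ∈ g i, p (x, y) := by
  have h : Partrec fun i => (f i).bind fun x => (g i).bind fun y =>
      Part.assert (p (x, y)) fun _ => Part.some () := by
    refine hf.bind ((hg.comp Computable.fst).bind ?_)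
    exact (Partrec.comp hp ((Computable.snd.comp .fst).pair .snd) :
      Partrec fun q : (ℕ × ℕ) × ℕ => Part.assert (p (q.1.2, q.2)) fun _ => Part.some ())
  refine h.dom_re.of_eq fun i => ?_
  simp only [Part.dom_iff_mem, Part.mem_bind_iff, Part.mem_assert_iff, Part.mem_some_iff]
  constructor
  · rintro ⟨_, x, hx, y, hy, h, -⟩
    exact ⟨x, hx, y, hy, h⟩
  · rintro ⟨x, hx, y, hy, h⟩
    exact ⟨(), x, hx, y, hy, h, trivial⟩

/-! ### Cohesive sets and eventual properties -/

/-- The filter of the sets that contain almost all of `C`. -/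
def almost (C : Set ℕ) : Filter ℕ := cofinite ⊓ 𝓟 C

theorem almostSubset_iff {C S : Set ℕ} : AlmostSubset C S ↔ ∀ᶠ i in almost C, i ∈ S := by
  rw [almost, eventually_inf_principal, eventually_cofinite, AlmostSubset]
  congr! 1
  ext i
  simp

theorem IsCohesive.neBot {C : Set ℕ} (hC : IsCohesive C) : (almost C).NeBot :=
  hC.1.cofinite_inf_principal_neBot

/-- The sets in `almost C` behave like an ultrafilter on the c.e. sets. -/
theorem IsCohesive.eventually_or {C : Set ℕ} (hC : IsCohesive C) {p : ℕ → Prop} (hp : REPred p) :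
    (∀ᶠ i in almost C, p i) ∨ ∀ᶠ i in almost C, ¬ p i := by
  rcases hC.2 {i | p i} hp with h | h
  · right
    refine (almostSubset_iff (S := {i | ¬ p i})).1 (h.subset ?_)
    rintro i ⟨hi, hn⟩
    exact ⟨not_not.1 hn, hi⟩
  · left
    refine (almostSubset_iff (S := {i | p i})).1 (h.subset ?_)
    rintro i ⟨hi, hn⟩
    exact ⟨hn, hi⟩

/-! ### Classes of the cohesive power -/

instance (A C : Set ℕ) : Countable (Domain A C) := by
  have : Countable (PreDomain A C) := by
    refine Function.Injective.countable
      (f := fun ψ : PreDomain A C => (⟨ψ.1, Partrec.nat_iff.2 ψ.2.1⟩ : {f : ℕ →. ℕ // Partrec f})) ?_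
    intro ψ φ h
    exact Subtype.ext ((Subtype.mk.injEq ..).mp h)
  exact inferInstanceAs (Countable (Quotient (eqSetoid A C)))

/-- The element of the cohesive power represented by `ψ`. -/
def mk {A C : Set ℕ} (ψ : PreDomain A C) : Domain A C := Quotient.mk (eqSetoid A C) ψ

/-- The constant function with value `a`. -/
def constFun {A : Set ℕ} (C : Set ℕ) (a : A) : PreDomain A C :=
  ⟨fun _ => Part.some a, Partrec.nat_iff.1 (Computable.const (a : ℕ)).partrec,
    fun i b hb => by rw [Part.mem_some_iff.1 hb]; exact a.2,
    almostSubset_iff.2 (Eventually.of_forall fun i => trivial)⟩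

section

variable {A C : Set ℕ} {E : A → A → Prop}

theorem mk_surjective (q : Domain A C) : ∃ ψ, mk ψ = q := Quotient.exists_rep q

theorem mk_eq_mk {ψ φ : PreDomain A C} :
    mk ψ = mk φ ↔ ∀ᶠ i in almost C, ∃ a, a ∈ ψ.1 i ∧ a ∈ φ.1 i :=
  Quotient.eq.trans almostSubset_iff

theorem rel_mk {ψ φ : PreDomain A C} : Rel E C (mk ψ) (mk φ) ↔
    ∀ᶠ i in almost C, ∃ a b : A, (a : ℕ) ∈ ψ.1 i ∧ (b : ℕ) ∈ φ.1 i ∧ E a b :=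
  almostSubset_iff

theorem PreDomain.eventually_mem (ψ : PreDomain A C) :
    ∀ᶠ i in almost C, ∃ a : A, (a : ℕ) ∈ ψ.1 i := by
  filter_upwards [almostSubset_iff.1 ψ.2.2.2] with i hi
  obtain ⟨a, ha⟩ := (PFun.mem_dom _ _).1 hi
  exact ⟨⟨a, ψ.2.2.1 i a ha⟩, ha⟩

theorem PreDomain.partrec (ψ : PreDomain A C) : Partrec ψ.1 := Partrec.nat_iff.2 ψ.2.1

theorem rel_equivalence (hE : Equivalence E) : Equivalence (Rel E C) where
  refl q := by
    obtain ⟨ψ, rfl⟩ := mk_surjective q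
    rw [rel_mk]
    filter_upwards [ψ.eventually_mem] with i ⟨a, ha⟩
    exact ⟨a, a, ha, ha, hE.refl a⟩
  symm {q q'} h := by
    obtain ⟨ψ, rfl⟩ := mk_surjective q
    obtain ⟨φ, rfl⟩ := mk_surjective q'
    rw [rel_mk] at h ⊢
    filter_upwards [h] with i ⟨a, b, ha, hb, hab⟩
    exact ⟨b, a, hb, ha, hE.symm hab⟩
  trans {q q' q''} h h' := by
    obtain ⟨ψ, rfl⟩ := mk_surjective q
    obtain ⟨φ, rfl⟩ := mk_surjective q'
    obtain ⟨χ, rfl⟩ := mk_surjective q''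
    rw [rel_mk] at h h' ⊢
    filter_upwards [h, h'] with i ⟨a, b, ha, hb, hab⟩ ⟨b', c, hb', hc, hbc⟩
    obtain rfl := Subtype.ext (Part.mem_unique hb hb')
    exact ⟨a, c, ha, hc, hE.trans hab hbc⟩

theorem rel_constFun (hC : IsCohesive C) (a b : A) :
    Rel E C (mk (constFun C a)) (mk (constFun C b)) ↔ E a b := by
  have := hC.neBot
  rw [rel_mk]
  constructor
  · intro h
    obtain ⟨i, a', b', ha, hb, hab⟩ := h.exists
    obtain rfl := Subtype.ext (Part.mem_some_iff.1 ha)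
    obtain rfl := Subtype.ext (Part.mem_some_iff.1 hb)
    exact hab
  · exact fun h => Eventually.of_forall fun i => ⟨a, b, Part.mem_some _, Part.mem_some _, h⟩

/-- The class of `[ψ]` has at least as many elements as almost all of the classes of the `ψ i`:
the functions taking `i` to the `j`-th element of the class of `ψ i`, for `j < n`, represent
distinct elements. -/
theorem le_encard_eqv_mk (hC : IsCohesive C) (hcomp : IsComputableStructure A E)
    {ψ : PreDomain A C} {n : ℕ}
    (h : ∀ᶠ i in almost C, ∃ a : A, (a : ℕ) ∈ ψ.1 i ∧ (n : ℕ∞) ≤ (eqv E a).encard) :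
    (n : ℕ∞) ≤ (eqv (Rel E C) (mk ψ)).encard := by
  classical
  have := hC.neBot
  have hp : ComputablePred (natRel E) := hcomp.2
  have hdom : ∀ j < n, ∀ᶠ i in almost C, ∃ a b : A, (a : ℕ) ∈ ψ.1 i ∧
      (b : ℕ) ∈ nthInClass (natRel E) j a ∧ E b a := by
    intro j hj
    filter_upwards [h] with i ⟨a, ha, hn⟩
    have hd : (nthInClass (natRel E) j a).Dom := by
      rw [nthInClass_dom, encard_natRel]
      exact (Nat.cast_le.2 hj).trans hn
    obtain ⟨b, hb⟩ := Part.dom_iff_mem.1 hd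
    obtain ⟨b', a', rfl, h2, hab⟩ := (mem_nthInClass hb).1
    obtain rfl := Subtype.ext h2
    exact ⟨a', b', ha, hb, hab⟩
  let φ : Fin n → PreDomain A C := fun j =>
    ⟨fun i => (ψ.1 i).bind (nthInClass (natRel E) j),
      Partrec.nat_iff.1 (ψ.partrec.bind ((partrec_nthInClass hp j).comp Computable.snd)),
      fun i b hb => by
        obtain ⟨a, -, hb⟩ := Part.mem_bind_iff.1 hb
        obtain ⟨b', -, h1, -⟩ := (mem_nthInClass hb).1
        have h1 : (b' : ℕ) = b := h1
        exact h1 ▸ b'.2,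
      almostSubset_iff.2 (by
        filter_upwards [hdom j j.2] with i ⟨a, b, ha, hb, _⟩
        exact Part.dom_iff_mem.2 ⟨b, Part.mem_bind_iff.2 ⟨a, ha, hb⟩⟩)⟩
  have hinj : Function.Injective fun j => mk (φ j) := by
    intro j k hjk
    obtain ⟨i, b, hb, hb'⟩ := (mk_eq_mk.1 hjk).exists
    obtain ⟨a, ha, hb⟩ := Part.mem_bind_iff.1 hb
    obtain ⟨a', ha', hb'⟩ := Part.mem_bind_iff.1 hb'
    obtain rfl := Part.mem_unique ha ha'
    exact Fin.ext ((mem_nthInClass hb).2.symm.trans (mem_nthInClass hb').2)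
  calc (n : ℕ∞) ≤ (Set.range fun j => mk (φ j)).encard := by simpa using hinj.encard_range
    _ ≤ _ := Set.encard_le_encard (by
        rintro _ ⟨j, rfl⟩
        refine rel_mk.2 ?_
        filter_upwards [hdom j j.2] with i ⟨a, b, ha, hb, hab⟩
        exact ⟨b, a, Part.mem_bind_iff.2 ⟨a, ha, hb⟩, ha, hab⟩)

/-- Finitely many distinct elements of the class of `[ψ]` take, at almost every `i ∈ C`, distinct
values in the class of `ψ i`, since the coincidence of two values is a c.e. event. -/
theorem eventually_le_encard (hC : IsCohesive C) {ψ : PreDomain A C} {n : ℕ}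
    (h : (n : ℕ∞) ≤ (eqv (Rel E C) (mk ψ)).encard) :
    ∀ᶠ i in almost C, ∃ a : A, (a : ℕ) ∈ ψ.1 i ∧ (n : ℕ∞) ≤ (eqv E a).encard := by
  obtain ⟨t, ht, htn⟩ := Set.exists_subset_encard_eq h
  have hfin : t.Finite := Set.finite_of_encard_eq_coe htn
  choose χ hχ using fun q : Domain A C => mk_surjective q
  have hrel : ∀ᶠ i in almost C, ∀ q ∈ t, ∃ a b : A, (a : ℕ) ∈ (χ q).1 i ∧ (b : ℕ) ∈ ψ.1 i ∧
      E a b := by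
    refine (eventually_all_finite hfin).2 fun q hq => rel_mk.1 ?_
    rw [hχ]
    exact ht hq
  have hne : ∀ᶠ i in almost C, ∀ q ∈ t, ∀ q' ∈ t, q ≠ q' →
      ¬ ∃ x ∈ (χ q).1 i, ∃ y ∈ (χ q').1 i, x = y := by
    refine (eventually_all_finite hfin).2 fun q _ => (eventually_all_finite hfin).2 fun q' _ => ?_
    refine eventually_imp_distrib_left.2 fun hqq => ?_
    refine (hC.eventually_or (REPred.exists_mem (p := fun p => p.1 = p.2)
      (ComputablePred.to_re (Primrec.eq (α := ℕ)).computablePred)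
      (χ q).partrec (χ q').partrec)).resolve_left fun hev => hqq ?_
    rw [← hχ q, ← hχ q', mk_eq_mk]
    filter_upwards [hev] with i ⟨x, hx, y, hy, hxy⟩
    exact ⟨x, hx, hxy ▸ hy⟩
  filter_upwards [hrel, hne, ψ.eventually_mem] with i hr hn ⟨a, ha⟩
  refine ⟨a, ha, ?_⟩
  have hv : ∀ q, ∃ b : A, q ∈ t → (b : ℕ) ∈ (χ q).1 i ∧ E b a := by
    intro q
    by_cases hq : q ∈ t
    · obtain ⟨b, a', hb, ha', hab⟩ := hr q hq
      obtain rfl := Subtype.ext (Part.mem_unique ha ha')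
      exact ⟨b, fun _ => ⟨hb, hab⟩⟩
    · exact ⟨a, fun h => absurd h hq⟩
  choose v hv using hv
  rw [← htn]
  refine Set.encard_le_encard_of_injOn (f := v) (fun q hq => (hv q hq).2) ?_
  intro q hq q' hq' hqq
  by_contra hne'
  exact hn q hq q' hq' hne' ⟨v q, (hv q hq).1, v q', (hv q' hq').1, congrArg _ hqq⟩

theorem le_encard_eqv_mk_iff (hC : IsCohesive C)
    (hcomp : IsComputableStructure A E) {ψ : PreDomain A C} {n : ℕ} :
    (n : ℕ∞) ≤ (eqv (Rel E C) (mk ψ)).encard ↔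
      ∀ᶠ i in almost C, ∃ a : A, (a : ℕ) ∈ ψ.1 i ∧ (n : ℕ∞) ≤ (eqv E a).encard :=
  ⟨eventually_le_encard hC, le_encard_eqv_mk hC hcomp⟩

theorem encard_eqv_constFun (hC : IsCohesive C)
    (hcomp : IsComputableStructure A E) (a : A) :
    (eqv (Rel E C) (mk (constFun C a))).encard = (eqv E a).encard := by
  have := hC.neBot
  refine ENat.eq_of_forall_natCast_le_iff fun n => ?_
  rw [le_encard_eqv_mk_iff hC hcomp]
  constructor
  · intro h
    obtain ⟨i, b, hb, hn⟩ := h.exists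
    obtain rfl := Subtype.ext (Part.mem_some_iff.1 hb)
    exact hn
  · exact fun h => Eventually.of_forall fun i => ⟨a, Part.mem_some _, h⟩

/-- Having at least `n` elements is a c.e. condition on a class, so it is decided almost
everywhere on `C`. -/
theorem eventually_not_le_encard (hC : IsCohesive C)
    (hcomp : IsComputableStructure A E) {ψ : PreDomain A C} {n : ℕ}
    (h : ¬ (n : ℕ∞) ≤ (eqv (Rel E C) (mk ψ)).encard) :
    ∀ᶠ i in almost C, ∀ a : A, (a : ℕ) ∈ ψ.1 i → ¬ (n : ℕ∞) ≤ (eqv E a).encard := by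
  have hp : ComputablePred (natRel E) := hcomp.2
  have hre : REPred fun q : ℕ × ℕ => (n : ℕ∞) ≤ {y | natRel E (y, q.1)}.encard :=
    Partrec.comp (rePred_le_encard hp n) Computable.fst
  rcases hC.eventually_or (REPred.exists_mem hre ψ.partrec ψ.partrec) with hev | hev
  · refine absurd (le_encard_eqv_mk hC hcomp ?_) h
    filter_upwards [hev, ψ.eventually_mem] with i ⟨x, hx, _, _, hn⟩ ⟨a, ha⟩
    obtain rfl := Part.mem_unique ha hx
    exact ⟨a, ha, by rwa [encard_natRel] at hn⟩
  · filter_upwards [hev] with i hi a ha hn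
    exact hi ⟨a, ha, a, ha, by rwa [encard_natRel]⟩

/-- A finite size of the class of `[ψ]` is the size of almost all classes of the `ψ i`. For an
infinite class this needs bounded character, under which any class with more elements than the
bound is infinite. -/
theorem eventually_encard_eq (hC : IsCohesive C)
    (hcomp : IsComputableStructure A E) {ψ : PreDomain A C}
    (h : HasBoundedCharacter E ∨ (eqv (Rel E C) (mk ψ)).encard ≠ ⊤) :
    ∀ᶠ i in almost C, ∃ a : A, (a : ℕ) ∈ ψ.1 i ∧
      (eqv E a).encard = (eqv (Rel E C) (mk ψ)).encard := by
  by_cases htop : (eqv (Rel E C) (mk ψ)).encard = ⊤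
  · obtain ⟨k, hk⟩ := h.resolve_right (not_not.2 htop)
    rw [htop]
    have hle : ((k + 1 : ℕ) : ℕ∞) ≤ (eqv (Rel E C) (mk ψ)).encard := htop ▸ le_top
    filter_upwards [eventually_le_encard hC hle] with i ⟨a, ha, hn⟩
    refine ⟨a, ha, ?_⟩
    by_contra hne
    have hf : (eqv E a).Finite := Set.encard_ne_top_iff.1 hne
    have := hk a hf
    rw [← hf.cast_ncard_eq, Nat.cast_le] at hn
    omega
  · obtain ⟨n, hn⟩ := ENat.ne_top_iff_exists.1 htop
    have hlt : ¬ ((n + 1 : ℕ) : ℕ∞) ≤ (eqv (Rel E C) (mk ψ)).encard := by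
      rw [← hn, Nat.cast_le]
      omega
    filter_upwards [eventually_le_encard hC hn.le,
      eventually_not_le_encard hC hcomp hlt] with i ⟨a, ha, h1⟩ h2
    refine ⟨a, ha, le_antisymm ?_ (hn ▸ h1)⟩
    rw [← hn]
    exact Order.le_of_lt_add_one (by simpa using h2 a ha)

/-- If the values of `ψ` lie almost everywhere in one of finitely many classes, then cohesiveness
chooses one of these classes, and `[ψ]` is equivalent to a constant. -/
theorem exists_rel_constFun (hC : IsCohesive C) (hE : Equivalence E)
    (hcomp : IsComputableStructure A E) {κ : ℕ∞} (hfin : (classesOfSize E κ).Finite)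
    {ψ : PreDomain A C}
    (h : ∀ᶠ i in almost C, ∃ a : A, (a : ℕ) ∈ ψ.1 i ∧ (eqv E a).encard = κ) :
    ∃ a, Rel E C (mk ψ) (mk (constFun C a)) := by
  have := hC.neBot
  have hp : ComputablePred (natRel E) := hcomp.2
  by_contra! hno
  have hev : ∀ᶠ i in almost C, ∀ S ∈ classesOfSize E κ, ∀ a : A, (a : ℕ) ∈ ψ.1 i → a ∉ S := by
    refine (eventually_all_finite hfin).2 ?_
    rintro _ ⟨⟨b, rfl⟩, -⟩
    rcases hC.eventually_or (REPred.exists_mem hp.to_re ψ.partrec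
      (constFun C b).partrec) with hev | hev
    · refine absurd (rel_mk.2 ?_) (hno b)
      filter_upwards [hev] with i ⟨x, hx, y, hy, a, b', h1, h2, hab⟩
      subst h1 h2
      exact ⟨a, b', hx, hy, hab⟩
    · filter_upwards [hev] with i hi a ha hab
      exact hi ⟨a, ha, b, Part.mem_some _, natRel_coe.2 hab⟩
  obtain ⟨i, ⟨a, ha, hκ⟩, hi⟩ := (h.and hev).exists
  exact hi _ ⟨⟨a, rfl⟩, hκ⟩ a ha (hE.refl a)

theorem hasInfinitelyManyInfiniteClasses_iff :
    HasInfinitelyManyInfiniteClasses E ↔ (classesOfSize E ⊤).Infinite := by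
  simp only [HasInfinitelyManyInfiniteClasses, classesOfSize, Set.encard_eq_top_iff]

theorem nonempty_relIso (hE : Equivalence E) (hcomp : IsComputableStructure A E)
    (hC : IsCohesive C) (h : HasBoundedCharacter E ∨ HasInfinitelyManyInfiniteClasses E) :
    Nonempty (Rel E C ≃r E) := by
  refine nonempty_relIso_of_classes hE (rel_equivalence hE) (fun a => mk (constFun C a))
    (rel_constFun hC) (encard_eqv_constFun hC hcomp) fun κ => ?_
  refine or_iff_not_imp_left.2 fun hfin q hq => ?_
  obtain ⟨ψ, rfl⟩ := mk_surjective q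
  refine exists_rel_constFun hC hE hcomp (Set.not_infinite.1 hfin) ?_
  rw [← hq]
  refine eventually_encard_eq hC hcomp (h.imp_right fun hinf htop => hfin ?_)
  rw [← hq, htop]
  exact hasInfinitelyManyInfiniteClasses_iff.1 hinf

/-! ### A new infinite class -/

theorem computablePred_sUnion {T : Set (Set A)} (hT : T.Finite)
    (h : ∀ S ∈ T, ComputablePred fun x : ℕ => ∃ a : A, (a : ℕ) = x ∧ a ∈ S) :
    ComputablePred fun x : ℕ => ∃ a : A, (a : ℕ) = x ∧ a ∈ ⋃₀ T := by
  induction T, hT using Set.Finite.induction_on with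
  | empty =>
    exact ((Computable.const false).computablePred (p := fun _ : ℕ => False)).of_eq (by simp)
  | @insert S T _ _ ih =>
    obtain ⟨_, h1⟩ := h S (Set.mem_insert _ _)
    obtain ⟨_, h2⟩ := ih fun S' hS' => h S' (Set.mem_insert_of_mem _ hS')
    refine ComputablePred.of_eq (p := fun x => (∃ a : A, (a : ℕ) = x ∧ a ∈ S) ∨
      ∃ a : A, (a : ℕ) = x ∧ a ∈ ⋃₀ T) (Computable.computablePred
      ((Primrec.or.to_comp.comp h1 h2).of_eq fun x => by simp)) fun x => ?_
    rw [Set.sUnion_insert]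
    simp only [Set.mem_union, and_or_left, exists_or]

/-- With unbounded character and only finitely many infinite classes, the union of the infinite
classes is computable. Hence a search finds, for each `i`, an element `ψ i` whose class is
finite and has more than `i` elements. -/
theorem exists_infinite_class (hC : IsCohesive C) (hE : Equivalence E)
    (hcomp : IsComputableStructure A E) (hb : ¬ HasBoundedCharacter E)
    (hfin : (classesOfSize E ⊤).Finite) :
    ∃ ψ : PreDomain A C, (eqv (Rel E C) (mk ψ)).encard = ⊤ ∧
      ∀ a : A, (eqv E a).encard = ⊤ → ¬ Rel E C (mk ψ) (mk (constFun C a)) := by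
  classical
  have := hC.neBot
  have hp : ComputablePred (natRel E) := hcomp.2
  have hU : ComputablePred fun x : ℕ => ∃ a : A, (a : ℕ) = x ∧ a ∈ ⋃₀ classesOfSize E ⊤ := by
    refine computablePred_sUnion hfin ?_
    rintro _ ⟨⟨b, rfl⟩, -⟩
    refine ComputablePred.of_eq (p := fun x : ℕ => natRel E (x, b)) (Computable.computablePred
      (hp.decide.comp (Computable.id.pair (Computable.const (b : ℕ))))) fun x => ?_
    constructor
    · rintro ⟨a, b', h1, h2, h⟩
      obtain rfl := Subtype.ext h2
      exact ⟨a, h1, h⟩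
    · rintro ⟨a, rfl, h⟩
      exact natRel_coe.2 h
  have hmemU : ∀ a : A, a ∈ ⋃₀ classesOfSize E ⊤ ↔ (eqv E a).encard = ⊤ := by
    intro a
    constructor
    · rintro ⟨_, ⟨⟨b, rfl⟩, hb⟩, hab⟩
      rwa [(eqv_eq_iff hE).2 hab]
    · exact fun h => ⟨_, ⟨⟨a, rfl⟩, h⟩, hE.refl a⟩
  -- `m` codes a pair `(x, y)`, where `y` is the `i`-th element (from `0`) of the
  -- class of `x`, so that this class has at least `i + 1` elements.
  let P : ℕ → ℕ → Prop := fun i m =>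
    (¬ ∃ a : A, (a : ℕ) = m.unpair.1 ∧ a ∈ ⋃₀ classesOfSize E ⊤) ∧
      natRel E (m.unpair.2, m.unpair.1) ∧
        Nat.count (fun y => natRel E (y, m.unpair.1)) m.unpair.2 = i
  have hP : ComputablePred fun q : ℕ × ℕ => P q.1 q.2 := by
    have hunp : Computable fun q : ℕ × ℕ => q.2.unpair :=
      Primrec.unpair.to_comp.comp Computable.snd
    refine Computable.computablePred ((Primrec.and.to_comp.comp
      (hU.not.decide.comp (Computable.fst.comp hunp))
      ((computablePred_count hp).decide.comp (hunp.pair Computable.fst))).of_eq fun q => ?_)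
    simp [P]
  have hex : ∀ i, ∃ m, P i m := by
    intro i
    simp only [HasBoundedCharacter, not_exists, not_forall, not_le] at hb
    obtain ⟨a, hf, hi⟩ := hb i
    have : ((i + 1 : ℕ) : ℕ∞) ≤ {y | natRel E (y, a)}.encard := by
      rw [encard_natRel, ← hf.cast_ncard_eq]
      exact Nat.cast_le.2 hi
    obtain ⟨y, hy, hc⟩ := succ_le_encard_iff.1 this
    refine ⟨Nat.pair a y, ?_, by simpa using hy, by simpa using hc⟩
    rintro ⟨a', h1, h2⟩
    obtain rfl : a' = a := Subtype.ext (by simpa using h1)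
    exact Set.encard_ne_top_iff.2 hf ((hmemU _).1 h2)
  let g : ℕ → ℕ := fun i => (Nat.find (hex i)).unpair.1
  have hg : Computable g :=
    Computable.fst.comp (Primrec.unpair.to_comp.comp (Computable.find hP hex))
  have hgA : ∀ i, ∃ a : A, (a : ℕ) = g i ∧ ((i + 1 : ℕ) : ℕ∞) ≤ (eqv E a).encard ∧
      (eqv E a).encard ≠ ⊤ := by
    intro i
    obtain ⟨h1, h2, h3⟩ := Nat.find_spec (hex i)
    obtain ⟨-, a, -, ha, -⟩ := id h2
    refine ⟨a, ha, ?_, fun htop => h1 ⟨a, ha, (hmemU a).2 htop⟩⟩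
    rw [← encard_natRel, ha]
    exact succ_le_encard_iff.2 ⟨_, h2, h3⟩
  refine ⟨⟨fun i => Part.some (g i), Partrec.nat_iff.1 hg.partrec, fun i b hb => ?_,
    almostSubset_iff.2 (Eventually.of_forall fun i => trivial)⟩, ?_, ?_⟩
  · obtain ⟨a, ha, -⟩ := hgA i
    rw [Part.mem_some_iff.1 hb, ← ha]
    exact a.2
  · refine ENat.eq_top_iff_forall_ge.2 fun n => le_encard_eqv_mk hC hcomp ?_
    have hev : ∀ᶠ i in almost C, n ≤ i :=
      Eventually.filter_mono inf_le_left (Nat.cofinite_eq_atTop ▸ eventually_ge_atTop n)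
    filter_upwards [hev] with i hi
    obtain ⟨a, ha, hn, -⟩ := hgA i
    exact ⟨a, Part.mem_some_iff.2 ha, (Nat.cast_le.2 (by omega)).trans hn⟩
  · intro b hb hrel
    obtain ⟨i, a, b', ha, hb', hab⟩ := (rel_mk.1 hrel).exists
    obtain rfl := Subtype.ext (Part.mem_some_iff.1 hb')
    obtain ⟨a', ha', -, hne⟩ := hgA i
    obtain rfl : a' = a := Subtype.ext (ha'.trans (Part.mem_some_iff.1 ha).symm)
    exact hne (((eqv_eq_iff hE).2 hab).symm ▸ hb)

theorem encard_eqv_relIso {α β : Type*} {r : α → α → Prop} {s : β → β → Prop} (f : r ≃r s)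
    (a : α) : (eqv s (f a)).encard = (eqv r a).encard := by
  rw [← f.injective.encard_image (eqv r a)]
  congr 1
  ext y
  constructor
  · intro hy
    refine ⟨f.symm y, ?_, f.apply_symm_apply y⟩
    refine f.map_rel_iff.1 ?_
    rw [f.apply_symm_apply]
    exact hy
  · rintro ⟨x, hx, rfl⟩
    exact f.map_rel_iff.2 hx

/-- An isomorphism from the power to `(A, E)`, preceded by the embedding by constants, induces an
injection of the finite set of infinite classes into itself. It is surjective, so every infinite
class of the power contains a constant. -/
theorem exists_rel_constFun_of_relIso (hC : IsCohesive C) (hE : Equivalence E)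
    (hcomp : IsComputableStructure A E) (hfin : (classesOfSize E ⊤).Finite)
    (f : Rel E C ≃r E) {q : Domain A C} (hq : (eqv (Rel E C) q).encard = ⊤) :
    ∃ a : A, (eqv E a).encard = ⊤ ∧ Rel E C q (mk (constFun C a)) := by
  have := hfin.to_subtype
  choose rep hrep using fun S : classesOfSize E ⊤ => S.2.1
  have hrep' : ∀ S, (eqv E (rep S)).encard = ⊤ := fun S => hrep S ▸ S.2.2
  let g : classesOfSize E ⊤ → classesOfSize E ⊤ := fun S =>
    ⟨eqv E (f (mk (constFun C (rep S)))), ⟨_, rfl⟩, by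
      rw [encard_eqv_relIso f, encard_eqv_constFun hC hcomp, hrep']⟩
  have hg : Function.Injective g := by
    intro S S' h
    have h1 := (eqv_eq_iff hE).1 (congrArg Subtype.val h)
    rw [f.map_rel_iff, rel_constFun hC] at h1
    exact Subtype.ext ((hrep S).trans (((eqv_eq_iff hE).2 h1).trans (hrep S').symm))
  obtain ⟨S, hS⟩ := Finite.surjective_of_injective hg
    ⟨eqv E (f q), ⟨_, rfl⟩, (encard_eqv_relIso f q).trans hq⟩
  refine ⟨rep S, hrep' S, (rel_equivalence hE).symm ?_⟩
  exact f.map_rel_iff.1 ((eqv_eq_iff hE).1 (congrArg Subtype.val hS))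

end

end CohesivePower

theorem mainTheorem1 (A : Set ℕ) (E : A → A → Prop) (hE : Equivalence E)
    (hcomp : CohesivePower.IsComputableStructure A E)
    (C : Set ℕ) (hC : CohesivePower.IsCohesive C) :
    Nonempty (CohesivePower.Rel E C ≃r E) ↔
      CohesivePower.HasBoundedCharacter E ∨
        CohesivePower.HasInfinitelyManyInfiniteClasses E := by
  refine ⟨?_, CohesivePower.nonempty_relIso hE hcomp hC⟩
  rintro ⟨f⟩
  by_contra! h
  have hfin := Set.not_infinite.1 (CohesivePower.hasInfinitelyManyInfiniteClasses_iff.not.1 h.2)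
  obtain ⟨ψ, htop, hno⟩ := CohesivePower.exists_infinite_class hC hE hcomp h.1 hfin
  obtain ⟨a, ha, hrel⟩ := CohesivePower.exists_rel_constFun_of_relIso hC hE hcomp hfin f htop
  exact hno a ha hrel
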